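/- Let $\mathcal{X}$ be a discrete-time birth-death process (random walk) on $\{0,1,2,\dots\}$ which from state $j$ moves in one step to $j+1$, $j-1$, $j$ with probability $p_j$, $q_j$, $r_j$, respectively, where $p_j>0$, $q_{j+1}>0$, $r_j\ge 0$ and $p_j+q_j+r_j=1$ for all $j\ge 0$, and $q_0=0$. Let $P_{ij}(n)=\Pr\{X(n)=j\mid X(0)=i\}=(P^n)_{ij}$ be its $n$-step transition probabilities, $P$ being the tridiagonal matrix of one-step transition probabilities, and put $\pi_0=1$ and $\pi_n=\dfrac{p_0p_1\cdots p_{n-1}}{q_1q_2\cdots q_n}$ for $n\ge 1$. If $$\sum_{j\ge 0}\frac{1}{p_j\pi_j}\sum_{k=0}^{j} r_k\pi_k=\infty ,$$ then $\mathcal{X}$ possesses the strong ratio limit property: for all states $i,j,k,l\in\{0,1,2,\dots\}$ one has $P_{kl}(n)\neq 0$ for all sufficiently large $n$, and the limit $$\lim_{n\to\infty}\frac{P_{ij}(n)}{P_{kl}(n)}$$ exists and is finite. -/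

import Mathlib

open Filter Topology

/-- The one-step transition probabilities of a discrete-time birth-death process (random walk)
on `{0, 1, 2, …}`: from state `j` the process moves to `j + 1`, `j - 1`, `j` with
probability `p j`, `q j`, `r j` respectively. -/
structure RandomWalk where
  p : ℕ → ℝ
  q : ℕ → ℝ
  r : ℕ → ℝ
  p_pos : ∀ j, 0 < p j
  q_zero : q 0 = 0
  q_succ_pos : ∀ j, 0 < q (j + 1)
  r_nonneg : ∀ j, 0 ≤ r j
  sum_eq_one : ∀ j, p j + q j + r j = 1

namespace RandomWalk

/-- The tridiagonal matrix `P` of one-step transition probabilities. -/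
def P (X : RandomWalk) (i j : ℕ) : ℝ :=
  if j = i + 1 then X.p i
  else if j = i then X.r i
  else if i = j + 1 then X.q i
  else 0

/-- The `n`-step transition probabilities `P_ij(n) = Pr{X(n) = j | X(0) = i} = (P ^ n)_ij`.
Every row of `P` has at most three nonzero entries, so the series is a finite sum. -/
noncomputable def nStep (X : RandomWalk) : ℕ → ℕ → ℕ → ℝ
  | 0, i, j => if i = j then 1 else 0
  | n + 1, i, j => ∑' k, X.P i k * nStep X n k j

/-- `π_n = (p_0 ⋯ p_{n-1}) / (q_1 ⋯ q_n)`, with `π_0 = 1`. -/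
noncomputable def piCoeff (X : RandomWalk) (n : ℕ) : ℝ :=
  (∏ k ∈ Finset.range n, X.p k) / ∏ k ∈ Finset.range n, X.q (k + 1)

/-- The strong ratio limit property: for all states `i, j, k, l` the ratio
`P_ij(n) / P_kl(n)` is well defined for all large `n` and has a finite limit as `n → ∞`.
(Interchanging `(i, j)` and `(k, l)` shows that all these limits are then positive.) -/
def HasSRLP (X : RandomWalk) : Prop :=
  ∀ i j k l : ℕ, (∀ᶠ n in atTop, X.nStep n k l ≠ 0) ∧
    ∃ L : ℝ, Tendsto (fun n => X.nStep n i j / X.nStep n k l) atTop (𝓝 L)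

end RandomWalk

namespace RandomWalk

variable (X : RandomWalk)

/-! By reversibility and Cauchy–Schwarz, P₀₀(n) behaves like a moment sequence: P₀₀(2n+2)/P₀₀(2n)
increases to some η² ≤ 1, and any ultrafilter limit of P₀₀(2n+k)/P₀₀(2n) has the form A η^k + B
(-η)^k (`tendsto_moment`). The backward equation carries this to P_i0, with Karlin–McGregor
polynomials Q_i(±η) as coefficients (`tendsto_of_backward`). Nonnegativity at even and odd times
gives B|Q_i(-η)| ≤ A Q_i(η).

The series enters only here: its divergence makes |Q_i(-η)|/Q_i(η) unbounded
(`nonpos_of_alternating_le`), so B = 0. Hence P_ij(2n+k)/P₀₀(2n) tends to η^k π_j Q_i(η) Q_j(η) > 0,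
and η^k cancels in ratios at equal times. -/

lemma piCoeff_pos (n : ℕ) : 0 < X.piCoeff n :=
  div_pos (Finset.prod_pos fun k _ => X.p_pos k) (Finset.prod_pos fun k _ => X.q_succ_pos k)

lemma piCoeff_zero : X.piCoeff 0 = 1 := by simp [piCoeff]

lemma q_nonneg (n : ℕ) : 0 ≤ X.q n := by
  cases n with
  | zero => exact X.q_zero.ge
  | succ n => exact (X.q_succ_pos n).le

lemma detailed_balance (n : ℕ) :
    X.piCoeff (n + 1) * X.q (n + 1) = X.piCoeff n * X.p n := by
  have h1 : ∏ k ∈ Finset.range n, X.q (k + 1) ≠ 0 :=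
    Finset.prod_ne_zero_iff.2 fun k _ => (X.q_succ_pos k).ne'
  have h2 := (X.q_succ_pos n).ne'
  simp only [piCoeff, Finset.prod_range_succ]
  field_simp

/-! ### Transition probabilities and reversibility -/

/-- Backward equation. The truncated `i - 1` is harmless since `q 0 = 0`. -/
lemma nStep_succ (n i j : ℕ) :
    X.nStep (n + 1) i j =
      X.q i * X.nStep n (i - 1) j + X.r i * X.nStep n i j + X.p i * X.nStep n (i + 1) j := by
  rw [nStep]
  cases i with
  | zero =>
    rw [tsum_eq_sum (s := {0, 1}) (by
      intro k hk
      simp only [Finset.mem_insert, Finset.mem_singleton, not_or] at hk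
      simp [P, hk.1, hk.2]), Finset.sum_pair (by simp)]
    simp [P, X.q_zero]
  | succ i =>
    rw [tsum_eq_sum (s := {i, i + 1, i + 2}) (by
      intro k hk
      simp only [Finset.mem_insert, Finset.mem_singleton, not_or] at hk
      have : ¬ i = k := fun h => hk.1 h.symm
      simp [P, this, hk.2.1, hk.2.2]), Finset.sum_insert (by simp), Finset.sum_pair (by simp)]
    simp [P, add_assoc]

lemma nStep_nonneg (n i j : ℕ) : 0 ≤ X.nStep n i j := by
  induction n generalizing i with
  | zero => rw [nStep]; split_ifs <;> simp
  | succ n ih =>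
    rw [nStep_succ]
    have := mul_nonneg (X.q_nonneg i) (ih (i - 1))
    have := mul_nonneg (X.r_nonneg i) (ih i)
    have := mul_nonneg (X.p_pos i).le (ih (i + 1))
    linarith

lemma nStep_le_one (n i j : ℕ) : X.nStep n i j ≤ 1 := by
  induction n generalizing i with
  | zero => rw [nStep]; split_ifs <;> simp
  | succ n ih =>
    rw [nStep_succ]
    have := mul_le_mul_of_nonneg_left (ih (i - 1)) (X.q_nonneg i)
    have := mul_le_mul_of_nonneg_left (ih i) (X.r_nonneg i)
    have := mul_le_mul_of_nonneg_left (ih (i + 1)) (X.p_pos i).le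
    linarith [X.sum_eq_one i]

/-- The loop 0 → 1 → 0 has positive probability. Odd times are excluded because r may vanish
identically. -/
lemma nStep_even_pos (n : ℕ) : 0 < X.nStep (2 * n) 0 0 := by
  induction n with
  | zero => simp [nStep]
  | succ n ih =>
    have h1 := X.nStep_succ (2 * n + 1) 0 0
    have h2 := X.nStep_succ (2 * n) 1 0
    have h3 := mul_pos (X.q_succ_pos 0) ih
    have h4 := mul_nonneg (X.r_nonneg 1) (X.nStep_nonneg (2 * n) 1 0)
    have h5 := mul_nonneg (X.p_pos 1).le (X.nStep_nonneg (2 * n) 2 0)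
    have h6 : 0 < X.nStep (2 * n + 1) 1 0 := by
      rw [h2]; simp only [Nat.sub_self, zero_add] at h3 ⊢; linarith
    have h7 := mul_pos (X.p_pos 0) h6
    have h8 := mul_nonneg (X.r_nonneg 0) (X.nStep_nonneg (2 * n + 1) 0 0)
    have h9 := X.q_zero
    rw [h9, zero_mul, zero_add, zero_add] at h1
    rw [show 2 * (n + 1) = 2 * n + 1 + 1 by ring, h1]
    linarith

/-- Chapman–Kolmogorov equation. -/
lemma nStep_add (a b i j M : ℕ) (hM : i + a < M) :
    X.nStep (a + b) i j = ∑ k ∈ Finset.range M, X.nStep a i k * X.nStep b k j := by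
  induction a generalizing i with
  | zero =>
    simp only [nStep, zero_add, ite_mul, one_mul, zero_mul, Finset.sum_ite_eq, Finset.mem_range]
    rw [if_pos (by omega)]
  | succ a ih =>
    rw [show a + 1 + b = a + b + 1 by ring, nStep_succ, ih _ (by omega), ih _ (by omega),
      ih _ (by omega), Finset.mul_sum, Finset.mul_sum, Finset.mul_sum, ← Finset.sum_add_distrib,
      ← Finset.sum_add_distrib]
    refine Finset.sum_congr rfl fun k _ => ?_
    rw [X.nStep_succ a]
    ring

lemma nStep_one (i j : ℕ) : X.nStep 1 i j = X.P i j := by simp [nStep]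

lemma piCoeff_mul_P_symm (i j : ℕ) : X.piCoeff i * X.P i j = X.piCoeff j * X.P j i := by
  wlog hij : i ≤ j generalizing i j
  · exact (this j i (by omega)).symm
  obtain rfl | h := hij.eq_or_lt
  · rfl
  obtain rfl | h := (Nat.succ_le_of_lt h).eq_or_lt
  · have := X.detailed_balance i
    simp [P, this, show ¬ i = i + 1 + 1 by omega]
  · have h1 : ¬ j = i + 1 := by omega
    have h2 : ¬ j = i := by omega
    have h3 : ¬ i = j + 1 := by omega
    have h4 : ¬ i = j := by omega
    simp [P, h1, h2, h3, h4]

lemma nStep_symm (n i j : ℕ) :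
    X.piCoeff i * X.nStep n i j = X.piCoeff j * X.nStep n j i := by
  induction n generalizing i j with
  | zero =>
    simp only [nStep]
    by_cases h : i = j
    · subst h; rfl
    · rw [if_neg h, if_neg (Ne.symm h)]; simp
  | succ n ih =>
    rw [X.nStep_add n 1 i j (i + j + n + 2) (by omega), add_comm n 1,
      X.nStep_add 1 n j i (i + j + n + 2) (by omega), Finset.mul_sum, Finset.mul_sum]
    refine Finset.sum_congr rfl fun k _ => ?_
    rw [← mul_assoc, ih, ← mul_assoc, nStep_one, nStep_one, ← piCoeff_mul_P_symm]
    ring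

/-- Cauchy–Schwarz for the moment functional `x ^ n ↦ P₀₀(n)`, applied to `x ^ a` and
`x ^ b - s * x ^ c`. -/
lemma nStep_cauchySchwarz (a b c : ℕ) (s : ℝ) :
    (X.nStep (a + b) 0 0 - s * X.nStep (a + c) 0 0) ^ 2 ≤
      X.nStep (2 * a) 0 0 * (X.nStep (2 * b) 0 0 - 2 * s * X.nStep (b + c) 0 0
        + s ^ 2 * X.nStep (2 * c) 0 0) := by
  set M := a + b + c + 1 with hM
  -- Symmetry turns P₀₀(m+n) into the inner product of `e m` and `e n`.
  set e : ℕ → ℕ → ℝ := fun n k => X.nStep n 0 k / √(X.piCoeff k) with he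
  have key : ∀ m n, m < M → X.nStep (m + n) 0 0 = ∑ k ∈ Finset.range M, e m k * e n k := by
    intro m n hm
    rw [X.nStep_add m n 0 0 M (by omega)]
    refine Finset.sum_congr rfl fun k _ => ?_
    have h := X.nStep_symm n k 0
    have hp := X.piCoeff_pos k
    rw [piCoeff_zero, one_mul] at h
    rw [he]
    simp only
    rw [div_mul_div_comm, Real.mul_self_sqrt hp.le, ← h]
    field_simp
  have h1 := Finset.sum_mul_sq_le_sq_mul_sq (Finset.range M) (e a) (fun k => e b k - s * e c k)
  rw [key a b (by omega), key a c (by omega), two_mul, two_mul, two_mul c, key a a (by omega),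
    key b b (by omega), key b c (by omega), key c c (by omega)]
  have e1 : ∑ k ∈ Finset.range M, e a k * e b k - s * ∑ k ∈ Finset.range M, e a k * e c k
      = ∑ k ∈ Finset.range M, e a k * (e b k - s * e c k) := by
    rw [Finset.mul_sum, ← Finset.sum_sub_distrib]
    exact Finset.sum_congr rfl fun k _ => by ring
  have e2 : ∑ k ∈ Finset.range M, e b k * e b k - 2 * s * ∑ k ∈ Finset.range M, e b k * e c k
      + s ^ 2 * ∑ k ∈ Finset.range M, e c k * e c k
      = ∑ k ∈ Finset.range M, (e b k - s * e c k) ^ 2 := by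
    rw [Finset.mul_sum, Finset.mul_sum, ← Finset.sum_sub_distrib, ← Finset.sum_add_distrib]
    exact Finset.sum_congr rfl fun k _ => by ring
  rw [e1, e2]
  simpa only [sq] using h1

/-! ### Karlin–McGregor polynomials -/

/-- The Karlin–McGregor polynomials. -/
noncomputable def birthDeathPoly (x : ℝ) : ℕ → ℝ
  | 0 => 1
  | 1 => (x - X.r 0) / X.p 0
  | n + 2 => ((x - X.r (n + 1)) * birthDeathPoly x (n + 1) - X.q (n + 1) * birthDeathPoly x n)
      / X.p (n + 1)

lemma birthDeathPoly_succ (x : ℝ) (n : ℕ) :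
    X.p n * X.birthDeathPoly x (n + 1) =
      (x - X.r n) * X.birthDeathPoly x n - X.q n * X.birthDeathPoly x (n - 1) := by
  have := (X.p_pos n).ne'
  cases n with
  | zero => simp only [birthDeathPoly, X.q_zero]; field_simp; ring
  | succ n => simp only [birthDeathPoly, Nat.add_sub_cancel]; field_simp

/-- A solution of the backward equation has asymptotics at all states governed by those at
state `0`. -/
lemma tendsto_of_backward {ι : Type*} {l : Filter ι} {N : ι → ℕ} {d : ι → ℝ} {a : ℕ → ℕ → ℝ}
    (ha : ∀ n i, a (n + 1) i = X.q i * a n (i - 1) + X.r i * a n i + X.p i * a n (i + 1))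
    {A B x y : ℝ}
    (h0 : ∀ k, Tendsto (fun t => a (N t + k) 0 / d t) l (𝓝 (A * x ^ k + B * y ^ k))) (i k : ℕ) :
    Tendsto (fun t => a (N t + k) i / d t) l
      (𝓝 (A * x ^ k * X.birthDeathPoly x i + B * y ^ k * X.birthDeathPoly y i)) := by
  induction i using Nat.strong_induction_on generalizing k with
  | _ i ih =>
    cases i with
    | zero => simpa [birthDeathPoly] using h0 k
    | succ i =>
      have hp := (X.p_pos i).ne'
      have h := (((ih i (by omega) (k + 1)).sub ((ih i (by omega) k).const_mul (X.r i))).sub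
        ((ih (i - 1) (by omega) k).const_mul (X.q i))).div_const (X.p i)
      convert h using 1
      · ext t
        rw [← add_assoc, ha]
        field_simp
        ring
      · congr 1
        rw [eq_div_iff hp]
        linear_combination A * x ^ k * X.birthDeathPoly_succ x i
          + B * y ^ k * X.birthDeathPoly_succ y i

/-- If the polynomials are positive at `x ∈ (0, 1]`, then divergence of the series forces
`|Q_n(-x)| / Q_n(x)` to be unbounded above. -/
lemma nonpos_of_alternating_le {x : ℝ} (hx1 : x ≤ 1)
    (hpos : ∀ n, 0 < X.birthDeathPoly x n)
    (h : Tendsto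
      (fun n : ℕ => ∑ j ∈ Finset.range n,
        1 / (X.p j * X.piCoeff j) * ∑ k ∈ Finset.range (j + 1), X.r k * X.piCoeff k)
      atTop atTop) {α β : ℝ}
    (hb : ∀ n, β * ((-1) ^ n * X.birthDeathPoly (-x) n) ≤ α * X.birthDeathPoly x n) : β ≤ 0 := by
  set Q := X.birthDeathPoly x with hQ
  set R : ℕ → ℝ := fun n => (-1) ^ n * X.birthDeathPoly (-x) n with hR
  have hQ0 : Q 0 = 1 := by simp [hQ, birthDeathPoly]
  have hR0 : R 0 = 1 := by simp [hR, birthDeathPoly]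
  have hQs : ∀ n, X.p n * Q (n + 1) = (x - X.r n) * Q n - X.q n * Q (n - 1) :=
    X.birthDeathPoly_succ x
  have hRs : ∀ n, X.p n * R (n + 1) = (x + X.r n) * R n - X.q n * R (n - 1) := by
    intro n
    have := X.birthDeathPoly_succ (-x) n
    cases n with
    | zero => simp only [hR, X.q_zero] at this ⊢; linear_combination (-1) * this
    | succ n =>
      simp only [hR, Nat.add_sub_cancel] at this ⊢
      linear_combination (-1) ^ (n + 2) * this
  -- Summation by parts: the left side equals -(1-x) ∑_{k≤n} π_k Q_k.
  have hanti : ∀ n, X.p n * X.piCoeff n * (Q (n + 1) - Q n) ≤ 0 := by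
    intro n
    have h2 := mul_nonneg (mul_nonneg (sub_nonneg.2 hx1) (hpos n).le) (X.piCoeff_pos n).le
    induction n with
    | zero =>
      have := hQs 0
      have hs := X.sum_eq_one 0
      rw [X.q_zero] at this hs
      have e : X.p 0 * X.piCoeff 0 * (Q (0 + 1) - Q 0) = - ((1 - x) * Q 0 * X.piCoeff 0) := by
        linear_combination X.piCoeff 0 * this - X.piCoeff 0 * Q 0 * hs
      rw [e]; linarith
    | succ n ih =>
      have ih := ih (mul_nonneg (mul_nonneg (sub_nonneg.2 hx1) (hpos n).le) (X.piCoeff_pos n).le)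
      have := hQs (n + 1)
      rw [Nat.add_sub_cancel] at this
      have hs := X.sum_eq_one (n + 1)
      have hd := X.detailed_balance n
      have e : X.p (n + 1) * X.piCoeff (n + 1) * (Q (n + 1 + 1) - Q (n + 1)) =
          X.p n * X.piCoeff n * (Q (n + 1) - Q n) - (1 - x) * Q (n + 1) * X.piCoeff (n + 1) := by
        linear_combination X.piCoeff (n + 1) * this - X.piCoeff (n + 1) * Q (n + 1) * hs
          + (Q (n + 1) - Q n) * hd
      rw [e]; linarith
  have hQanti : Antitone Q := antitone_nat_of_succ_le fun n => by
    have := hanti n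
    have := nonpos_of_mul_nonpos_right this (mul_pos (X.p_pos n) (X.piCoeff_pos n))
    linarith
  -- The discrete Wronskian: W_n = 2 ∑_{k≤n} r_k π_k Q_k R_k, and it governs the increments of R/Q.
  set W : ℕ → ℝ := fun n => X.p n * X.piCoeff n * (R (n + 1) * Q n - R n * Q (n + 1)) with hW
  set S : ℕ → ℝ := fun n => ∑ k ∈ Finset.range (n + 1), X.r k * X.piCoeff k with hS
  have hSn : ∀ n, 0 ≤ S n := fun n => Finset.sum_nonneg fun k _ =>
    mul_nonneg (X.r_nonneg k) (X.piCoeff_pos k).le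
  have hW0 : W 0 = 2 * (X.r 0 * X.piCoeff 0) * (Q 0 * R 0) := by
    have h1 := hQs 0
    have h2 := hRs 0
    rw [X.q_zero] at h1 h2
    simp only [hW]
    linear_combination X.piCoeff 0 * Q 0 * h2 - X.piCoeff 0 * R 0 * h1
  have hWs : ∀ n, W (n + 1) = W n
      + 2 * (X.r (n + 1) * X.piCoeff (n + 1)) * (Q (n + 1) * R (n + 1)) := by
    intro n
    have h1 := hQs (n + 1)
    have h2 := hRs (n + 1)
    have hd := X.detailed_balance n
    rw [Nat.add_sub_cancel] at h1 h2
    simp only [hW]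
    linear_combination X.piCoeff (n + 1) * Q (n + 1) * h2 - X.piCoeff (n + 1) * R (n + 1) * h1
      + (R (n + 1) * Q n - R n * Q (n + 1)) * hd
  have hstep : ∀ n, 2 * S n * Q n ^ 2 ≤ W n →
      R n / Q n + 2 * (1 / (X.p n * X.piCoeff n) * S n) ≤ R (n + 1) / Q (n + 1) := by
    intro n hn
    have hc := mul_pos (X.p_pos n) (X.piCoeff_pos n)
    have h1 := hpos n
    have h2 := hpos (n + 1)
    have e : R (n + 1) / Q (n + 1) - R n / Q n
        = W n / (X.p n * X.piCoeff n * (Q n * Q (n + 1))) := by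
      have := (X.p_pos n).ne'
      have := (X.piCoeff_pos n).ne'
      simp only [hW]
      field_simp
    have h3 : 2 * (1 / (X.p n * X.piCoeff n) * S n)
        ≤ W n / (X.p n * X.piCoeff n * (Q n * Q (n + 1))) := by
      rw [le_div_iff₀ (by positivity)]
      calc 2 * (1 / (X.p n * X.piCoeff n) * S n) * (X.p n * X.piCoeff n * (Q n * Q (n + 1)))
          = 2 * S n * (Q n * Q (n + 1)) := by
            have := (X.p_pos n).ne'
            have := (X.piCoeff_pos n).ne'
            field_simp
        _ ≤ 2 * S n * (Q n * Q n) := by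
            have := hSn n
            have := hQanti (Nat.le_succ n)
            gcongr
        _ ≤ W n := by rw [← sq]; exact hn
    linarith
  -- A joint induction: R ≥ Q and Q decreasing bound W from below, which in turn makes R/Q grow.
  have hmain : ∀ n, 1 ≤ R n / Q n ∧ 2 * S n * Q n ^ 2 ≤ W n := by
    intro n
    induction n with
    | zero =>
      refine ⟨by rw [hQ0, hR0]; norm_num, ?_⟩
      rw [hW0, hQ0, hR0]
      simp [hS]
    | succ n ih =>
      have h1 := hstep n ih.2
      have h2 : 0 ≤ 2 * (1 / (X.p n * X.piCoeff n) * S n) := by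
        have := hSn n
        have := mul_pos (X.p_pos n) (X.piCoeff_pos n)
        positivity
      have h3 : 1 ≤ R (n + 1) / Q (n + 1) := by linarith [ih.1]
      refine ⟨h3, ?_⟩
      rw [le_div_iff₀ (hpos _), one_mul] at h3
      have h4 : S (n + 1) = S n + X.r (n + 1) * X.piCoeff (n + 1) := Finset.sum_range_succ _ _
      have h5 : Q (n + 1) ^ 2 ≤ Q n ^ 2 := by
        have := hpos (n + 1)
        have := hQanti (Nat.le_succ n)
        gcongr
      have h6 := mul_le_mul_of_nonneg_left h5 (hSn n)
      have h7 := mul_le_mul_of_nonneg_left (mul_le_mul_of_nonneg_left h3 (hpos (n + 1)).le)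
        (mul_nonneg (X.r_nonneg (n + 1)) (X.piCoeff_pos (n + 1)).le)
      rw [hWs, h4]
      nlinarith [ih.2]
  have hlow : ∀ n, 2 * ∑ j ∈ Finset.range n, 1 / (X.p j * X.piCoeff j) * S j ≤ R n / Q n := by
    intro n
    induction n with
    | zero => rw [Finset.sum_range_zero, mul_zero]; linarith [(hmain 0).1]
    | succ n ih => rw [Finset.sum_range_succ, mul_add]; linarith [hstep n (hmain n).2]
  by_contra! hβ
  obtain ⟨n, hn⟩ := (h.eventually_gt_atTop (max (α / β) 0)).exists
  have h1 : α / β < R n / Q n := by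
    have h2 := hlow n
    have h3 := le_max_left (α / β) 0
    have h4 := le_max_right (α / β) 0
    linarith
  rw [div_lt_div_iff₀ hβ (hpos n), mul_comm (R n)] at h1
  exact (hb n).not_gt h1


/-! ### Ratios at even times -/

lemma nStep_even_ratio_monotone :
    Monotone fun n => X.nStep (2 * (n + 1)) 0 0 / X.nStep (2 * n) 0 0 := by
  have hm := X.nStep_even_pos
  refine monotone_nat_of_le_succ fun n => ?_
  have h := X.nStep_cauchySchwarz n (n + 2) 0 0
  rw [zero_mul, sub_zero, mul_zero, zero_mul, sub_zero, zero_pow two_ne_zero, zero_mul, add_zero,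
    show n + (n + 2) = 2 * (n + 1) by ring] at h
  rw [div_le_div_iff₀ (hm _) (hm _), ← sq, mul_comm (X.nStep (2 * (n + 1 + 1)) 0 0)]
  exact h

/-- A single ratio above 1 would, by monotonicity of the ratios, force geometric growth of
probabilities. -/
lemma nStep_even_antitone : Antitone fun n => X.nStep (2 * n) 0 0 := by
  have hm := X.nStep_even_pos
  set ρ : ℕ → ℝ := fun n => X.nStep (2 * (n + 1)) 0 0 / X.nStep (2 * n) 0 0 with hρ
  have hmono : Monotone ρ := X.nStep_even_ratio_monotone
  refine antitone_nat_of_succ_le fun N => ?_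
  by_contra! hN
  have h1 : 1 < ρ N := (one_lt_div (hm N)).2 hN
  have h2 : ∀ k, X.nStep (2 * N) 0 0 * ρ N ^ k ≤ X.nStep (2 * (N + k)) 0 0 := by
    intro k
    induction k with
    | zero => simp
    | succ k ih =>
      have h3 := hmono (Nat.le_add_right N k)
      have h4 : X.nStep (2 * (N + (k + 1))) 0 0 = X.nStep (2 * (N + k)) 0 0 * ρ (N + k) := by
        simp only [hρ]
        rw [mul_div_cancel₀ _ (hm _).ne', add_assoc]
      rw [h4, pow_succ, ← mul_assoc]
      exact mul_le_mul ih h3 (by positivity) (hm _).le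
  obtain ⟨k, hk⟩ := pow_unbounded_of_one_lt (1 / X.nStep (2 * N) 0 0) h1
  rw [div_lt_iff₀ (hm N)] at hk
  linarith [h2 k, X.nStep_le_one (2 * (N + k)) 0 0]

/-- The limit is the square of the decay parameter of the process. -/
lemma exists_tendsto_even_ratio : ∃ η : ℝ, 0 < η ∧ η ≤ 1 ∧
    Tendsto (fun n => X.nStep (2 * (n + 1)) 0 0 / X.nStep (2 * n) 0 0) atTop (𝓝 (η ^ 2)) := by
  have hm := X.nStep_even_pos
  set ρ : ℕ → ℝ := fun n => X.nStep (2 * (n + 1)) 0 0 / X.nStep (2 * n) 0 0 with hρ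
  have hmono : Monotone ρ := X.nStep_even_ratio_monotone
  have hle : ∀ n, ρ n ≤ 1 := fun n =>
    (div_le_one (hm n)).2 (X.nStep_even_antitone (Nat.le_succ n))
  have hlim := tendsto_atTop_ciSup hmono ⟨1, by rintro _ ⟨n, rfl⟩; exact hle n⟩
  have hpos : 0 < ⨆ n, ρ n :=
    (div_pos (hm 1) (hm 0)).trans_le (hmono.ge_of_tendsto hlim 0)
  refine ⟨√(⨆ n, ρ n), Real.sqrt_pos.2 hpos, ?_, ?_⟩
  · exact Real.sqrt_le_one.2 (le_of_tendsto' hlim hle)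
  · rwa [Real.sq_sqrt hpos.le]

/-! ### Limits of normalized moments -/

lemma tendsto_moment_add_two {η : ℝ}
    (hη : Tendsto (fun n => X.nStep (2 * (n + 1)) 0 0 / X.nStep (2 * n) 0 0) atTop (𝓝 (η ^ 2)))
    (k : ℕ) :
    Tendsto (fun n => X.nStep (2 * n + (k + 2)) 0 0 / X.nStep (2 * n) 0 0
      - η ^ 2 * (X.nStep (2 * n + k) 0 0 / X.nStep (2 * n) 0 0)) atTop (𝓝 0) := by
  have hm := X.nStep_even_pos
  have h4 : Tendsto (fun n => X.nStep (2 * (n + 2)) 0 0 / X.nStep (2 * n) 0 0) atTop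
      (𝓝 (η ^ 2 * η ^ 2)) := by
    refine ((hη.comp (tendsto_add_atTop_nat 1)).mul hη).congr fun n => ?_
    exact div_mul_div_cancel₀ (hm _).ne'
  have hb : Tendsto (fun n => X.nStep (2 * (n + 2)) 0 0 / X.nStep (2 * n) 0 0
      - 2 * η ^ 2 * (X.nStep (2 * (n + 1)) 0 0 / X.nStep (2 * n) 0 0) + (η ^ 2) ^ 2) atTop
      (𝓝 0) := by
    convert (h4.sub (hη.const_mul (2 * η ^ 2))).add_const ((η ^ 2) ^ 2) using 2
    ring
  have hsq : Tendsto (fun n => (X.nStep (2 * n + (k + 2)) 0 0 / X.nStep (2 * n) 0 0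
      - η ^ 2 * (X.nStep (2 * n + k) 0 0 / X.nStep (2 * n) 0 0)) ^ 2) atTop (𝓝 0) := by
    refine squeeze_zero (fun n => sq_nonneg _) (fun n => ?_) hb
    -- Pairs x^(n+k) with x^n (x² - η²), whose normalized squared norm tends to η⁴ - 2η⁴ + η⁴ = 0.
    have h := X.nStep_cauchySchwarz (n + k) (n + 2) n (η ^ 2)
    rw [show n + k + (n + 2) = 2 * n + (k + 2) by ring, show n + k + n = 2 * n + k by ring,
      show n + 2 + n = 2 * (n + 1) by ring] at h
    have hle := X.nStep_even_antitone (Nat.le_add_right n k)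
    have hn := hm n
    simp only at hle
    have hB : 0 ≤ X.nStep (2 * (n + 2)) 0 0 - 2 * η ^ 2 * X.nStep (2 * (n + 1)) 0 0
        + (η ^ 2) ^ 2 * X.nStep (2 * n) 0 0 :=
      nonneg_of_mul_nonneg_right ((sq_nonneg _).trans h) (hm (n + k))
    have h2 := h.trans (mul_le_mul_of_nonneg_right hle hB)
    have e1 : (X.nStep (2 * n + (k + 2)) 0 0 / X.nStep (2 * n) 0 0
        - η ^ 2 * (X.nStep (2 * n + k) 0 0 / X.nStep (2 * n) 0 0)) ^ 2
        = (X.nStep (2 * n + (k + 2)) 0 0 - η ^ 2 * X.nStep (2 * n + k) 0 0) ^ 2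
          / X.nStep (2 * n) 0 0 ^ 2 := by
      field_simp
    have e2 : X.nStep (2 * (n + 2)) 0 0 / X.nStep (2 * n) 0 0
        - 2 * η ^ 2 * (X.nStep (2 * (n + 1)) 0 0 / X.nStep (2 * n) 0 0) + (η ^ 2) ^ 2
        = (X.nStep (2 * n) 0 0 * (X.nStep (2 * (n + 2)) 0 0
          - 2 * η ^ 2 * X.nStep (2 * (n + 1)) 0 0 + (η ^ 2) ^ 2 * X.nStep (2 * n) 0 0))
          / X.nStep (2 * n) 0 0 ^ 2 := by
      field_simp
    rw [e1, e2]
    gcongr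
  simpa [Real.sqrt_sq_eq_abs, tendsto_zero_iff_abs_tendsto_zero, Function.comp_def] using
    (Real.continuous_sqrt.tendsto 0).comp hsq

/-- If the odd moments, normalized by the even ones, converge along `l`, then so do all of them, and
the limits are the moments of a measure on `{η, -η}`. -/
lemma tendsto_moment {η : ℝ}
    (hη : Tendsto (fun n => X.nStep (2 * (n + 1)) 0 0 / X.nStep (2 * n) 0 0) atTop (𝓝 (η ^ 2)))
    {l : Filter ℕ} (hl : l ≤ atTop) {A B : ℝ} (hAB : A + B = 1)
    (h1 : Tendsto (fun n => X.nStep (2 * n + 1) 0 0 / X.nStep (2 * n) 0 0) l (𝓝 (A * η - B * η)))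
    (k : ℕ) :
    Tendsto (fun n => X.nStep (2 * n + k) 0 0 / X.nStep (2 * n) 0 0) l
      (𝓝 (A * η ^ k + B * (-η) ^ k)) := by
  induction k using Nat.twoStepInduction with
  | zero =>
    refine tendsto_const_nhds.congr fun n => ?_
    rw [add_zero, div_self (X.nStep_even_pos n).ne', pow_zero, pow_zero, mul_one, mul_one, hAB]
  | one => simpa [sub_eq_add_neg] using h1
  | more k ih _ =>
    convert ((X.tendsto_moment_add_two hη k).mono_left hl).add (ih.const_mul (η ^ 2)) using 2
    · ring
    · ring

lemma birthDeathPoly_pos {x : ℝ} (h : ∀ n, 0 ≤ X.birthDeathPoly x n) (n : ℕ) :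
    0 < X.birthDeathPoly x n := by
  induction n with
  | zero => simp [birthDeathPoly]
  | succ n ih =>
    refine (h _).lt_of_ne' fun h0 => ?_
    have h1 := X.birthDeathPoly_succ x (n + 1)
    rw [h0, Nat.add_sub_cancel, mul_zero, zero_sub] at h1
    linarith [mul_pos (X.q_succ_pos n) ih, mul_nonneg (X.p_pos (n + 1)).le (h (n + 1 + 1))]

/-- `P₀₀(2n+1) / P₀₀(2n)` converges to the decay parameter, at which the polynomials are positive. -/
lemma tendsto_odd_ratio {η : ℝ} (hη0 : 0 < η) (hη1 : η ≤ 1)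
    (hη : Tendsto (fun n => X.nStep (2 * (n + 1)) 0 0 / X.nStep (2 * n) 0 0) atTop (𝓝 (η ^ 2)))
    (h : Tendsto
      (fun n : ℕ => ∑ j ∈ Finset.range n,
        1 / (X.p j * X.piCoeff j) * ∑ k ∈ Finset.range (j + 1), X.r k * X.piCoeff k)
      atTop atTop) :
    Tendsto (fun n => X.nStep (2 * n + 1) 0 0 / X.nStep (2 * n) 0 0) atTop (𝓝 η) ∧
      ∀ n, 0 < X.birthDeathPoly η n := by
  have hm := X.nStep_even_pos
  have hsq : ∀ n, (X.nStep (2 * n + 1) 0 0 / X.nStep (2 * n) 0 0) ^ 2 ≤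
      X.nStep (2 * (n + 1)) 0 0 / X.nStep (2 * n) 0 0 := by
    intro n
    have h := X.nStep_cauchySchwarz n (n + 1) 0 0
    rw [zero_mul, sub_zero, mul_zero, zero_mul, sub_zero, zero_pow two_ne_zero, zero_mul, add_zero,
      show n + (n + 1) = 2 * n + 1 by ring] at h
    rw [div_pow, div_le_div_iff₀ (pow_pos (hm n) 2) (hm n)]
    calc _ ≤ _ := mul_le_mul_of_nonneg_right h (hm n).le
      _ = _ := by ring
  have hmem : ∀ n, X.nStep (2 * n + 1) 0 0 / X.nStep (2 * n) 0 0 ∈ Set.Icc (0 : ℝ) 1 := fun n =>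
    ⟨div_nonneg (X.nStep_nonneg _ _ _) (hm n).le,
      (sq_le_one_iff₀ (div_nonneg (X.nStep_nonneg _ _ _) (hm n).le)).1
        ((hsq n).trans ((div_le_one (hm n)).2 (X.nStep_even_antitone (Nat.le_succ n))))⟩
  -- Convergence of the odd ratios is not yet known, so compactness supplies limits along
  -- ultrafilters, all to be identified with η.
  have key : ∀ U : Ultrafilter ℕ, (U : Filter ℕ) ≤ atTop →
      Tendsto (fun n => X.nStep (2 * n + 1) 0 0 / X.nStep (2 * n) 0 0) U (𝓝 η) ∧
        ∀ n, 0 < X.birthDeathPoly η n := by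
    intro U hU
    obtain ⟨c, ⟨hc0, -⟩, hc⟩ := isCompact_Icc.ultrafilter_le_nhds
      (U.map fun n => X.nStep (2 * n + 1) 0 0 / X.nStep (2 * n) 0 0)
      (le_principal_iff.2 (mem_map.2 (univ_mem' hmem)))
    have hc : Tendsto (fun n => X.nStep (2 * n + 1) 0 0 / X.nStep (2 * n) 0 0) U (𝓝 c) := hc
    have hcη : c ≤ η :=
      abs_le_of_sq_le_sq' (le_of_tendsto_of_tendsto' (hc.pow 2) (hη.mono_left hU) hsq) hη0.le |>.2
    -- The solution of A + B = 1, (A - B) η = c.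
    set A := (1 + c / η) / 2 with hA
    set B := (1 - c / η) / 2 with hB
    have hA0 : 0 < A := half_pos (by positivity)
    have hB0 : 0 ≤ B := by
      have := (div_le_one hη0).2 hcη
      rw [hB]; linarith
    have hcAB : c = A * η - B * η := by rw [hA, hB]; field_simp; ring
    have hmom := X.tendsto_moment hη hU (A := A) (B := B) (by ring) (hcAB ▸ hc)
    have hlim := X.tendsto_of_backward (a := fun n i => X.nStep n i 0) (N := fun n => 2 * n)
      (fun n i => X.nStep_succ n i 0) hmom
    have hnn : ∀ i k,
        0 ≤ A * η ^ k * X.birthDeathPoly η i + B * (-η) ^ k * X.birthDeathPoly (-η) i :=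
      fun i k => ge_of_tendsto' (hlim i k) fun n => div_nonneg (X.nStep_nonneg _ _ _) (hm n).le
    have hplus : ∀ i, 0 ≤ A * X.birthDeathPoly η i + B * X.birthDeathPoly (-η) i := fun i => by
      simpa using hnn i 0
    have hminus : ∀ i, 0 ≤ A * X.birthDeathPoly η i - B * X.birthDeathPoly (-η) i := fun i => by
      refine nonneg_of_mul_nonneg_right ?_ hη0
      rw [show η * (A * X.birthDeathPoly η i - B * X.birthDeathPoly (-η) i)
        = A * η ^ 1 * X.birthDeathPoly η i + B * (-η) ^ 1 * X.birthDeathPoly (-η) i by ring]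
      exact hnn i 1
    have hQ := X.birthDeathPoly_pos (x := η) fun i =>
      nonneg_of_mul_nonneg_right (by linarith [hplus i, hminus i]) hA0
    refine ⟨?_, hQ⟩
    have hB' : B ≤ 0 := X.nonpos_of_alternating_le hη1 hQ h (α := A) fun n => by
      rcases neg_one_pow_eq_or ℝ n with e | e <;> rw [e]
      · linarith [hminus n]
      · linarith [hplus n]
    have hB0' : B = 0 := le_antisymm hB' hB0
    have : c = η := by
      rw [hB, div_eq_zero_iff, or_iff_left two_ne_zero, sub_eq_zero, eq_div_iff hη0.ne'] at hB0'
      linarith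
    exact this ▸ hc
  refine ⟨?_, (key (Ultrafilter.of atTop) (Ultrafilter.of_le atTop)).2⟩
  exact tendsto_iff_ultrafilter _ _ _ |>.2 fun U hU => (key U hU).1

lemma tendsto_atTop_of_even_odd {α : Type*} {f : ℕ → α} {l : Filter α}
    (h0 : Tendsto (fun n => f (2 * n)) atTop l) (h1 : Tendsto (fun n => f (2 * n + 1)) atTop l) :
    Tendsto f atTop l := by
  intro s hs
  obtain ⟨a, ha⟩ := eventually_atTop.1 (h0 hs)
  obtain ⟨b, hb⟩ := eventually_atTop.1 (h1 hs)
  refine mem_map.2 (mem_atTop_sets.2 ⟨2 * (a + b), fun n hn => ?_⟩)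
  obtain ⟨k, rfl | rfl⟩ := n.even_or_odd'
  · exact ha k (by omega)
  · exact hb k (by omega)

end RandomWalk

theorem theorem1 (X : RandomWalk)
    (h : Tendsto
      (fun n : ℕ => ∑ j ∈ Finset.range n,
        1 / (X.p j * X.piCoeff j) * ∑ k ∈ Finset.range (j + 1), X.r k * X.piCoeff k)
      atTop atTop) :
    X.HasSRLP := by
  obtain ⟨η, hη0, hη1, hη⟩ := X.exists_tendsto_even_ratio
  obtain ⟨hodd, hQ⟩ := X.tendsto_odd_ratio hη0 hη1 hη h
  have hcol := X.tendsto_of_backward (a := fun n i => X.nStep n i 0) (N := fun n => 2 * n)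
    (fun n i => X.nStep_succ n i 0)
    (X.tendsto_moment hη le_rfl (A := 1) (B := 0) (by norm_num) (by simpa using hodd))
  have hsym : ∀ n i j, X.nStep n i j / X.piCoeff j = X.nStep n j i / X.piCoeff i := fun n i j => by
    rw [div_eq_div_iff (X.piCoeff_pos j).ne' (X.piCoeff_pos i).ne']
    linarith [X.nStep_symm n i j]
  have hall : ∀ i j k, Tendsto (fun n => X.nStep (2 * n + k) i j / X.nStep (2 * n) 0 0) atTop
      (𝓝 (η ^ k * (X.piCoeff j * X.birthDeathPoly η i * X.birthDeathPoly η j))) := by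
    intro i j k
    -- Second use of the backward equation, now in the other index via symmetry; y = 0 is a dummy
    -- since B = 0.
    have hrow := X.tendsto_of_backward (a := fun n j => X.nStep n j i / X.piCoeff i)
      (N := fun n => 2 * n) (d := fun n => X.nStep (2 * n) 0 0) (l := atTop)
      (A := X.birthDeathPoly η i) (B := 0) (x := η) (y := 0)
      (fun n j => by
        simp only [X.nStep_succ]
        ring)
      (fun k => by
        convert hcol i k using 2
        · rw [← hsym, RandomWalk.piCoeff_zero, div_one]
        · ring) j k
    convert hrow.const_mul (X.piCoeff j) using 2
    · rw [← hsym]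
      have := (X.piCoeff_pos j).ne'
      field_simp
    · ring
  have hm := X.nStep_even_pos
  intro i j k l
  have hpos : ∀ i j e, 0 < η ^ e * (X.piCoeff j * X.birthDeathPoly η i * X.birthDeathPoly η j) :=
    fun i j e => mul_pos (pow_pos hη0 e) (mul_pos (mul_pos (X.piCoeff_pos j) (hQ i)) (hQ j))
  have hne : ∀ e, ∀ᶠ n in atTop, X.nStep (2 * n + e) k l ≠ 0 := fun e =>
    ((hall k l e).eventually_ne (hpos k l e).ne').mono fun n hn h0 => hn (by rw [h0, zero_div])
  have hratio : ∀ e, Tendsto (fun n => X.nStep (2 * n + e) i j / X.nStep (2 * n + e) k l) atTop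
      (𝓝 ((X.piCoeff j * X.birthDeathPoly η i * X.birthDeathPoly η j) /
        (X.piCoeff l * X.birthDeathPoly η k * X.birthDeathPoly η l))) := fun e => by
    have h := (hall i j e).div (hall k l e) (hpos k l e).ne'
    rw [mul_div_mul_left _ _ (pow_pos hη0 e).ne'] at h
    exact h.congr fun n => div_div_div_cancel_right₀ (hm n).ne' _ _
  refine ⟨?_, _, RandomWalk.tendsto_atTop_of_even_odd (hratio 0) (hratio 1)⟩
  have h0 : Tendsto (fun n => X.nStep n k l) atTop (𝓟 {0}ᶜ) :=
    RandomWalk.tendsto_atTop_of_even_odd (tendsto_principal.2 (hne 0)) (tendsto_principal.2 (hne 1))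
  exact tendsto_principal.1 h0
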